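/- Let $A$ be a free abelian group that is not finitely generated, and let $(x_i, y_i : i \in I)$ be a basis of $A$ (that is, $(x_i)_{i\in I}$ and $(y_i)_{i \in I}$ together form a basis of $A$, all listed elements being distinct). Then there is a unique automorphism $\tau \in \operatorname{Aut} A$ with $$\tau x_i = x_i + y_i, \qquad \tau y_i = y_i \qquad (i \in I),$$ and the normal closure of $\tau$ in $\operatorname{Aut} A$ is the whole group $\operatorname{Aut} A$. -/

import Mathlib

/-! Write `A` as `F × F` with `F` free of infinite rank; then `τ` is the shear by the identity, and
`N` is its normal closure. Conjugation gives the shears by automorphisms; as endomorphisms of `F`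
are sums of automorphisms, `N` contains every shear, for every such decomposition
(`transportAut_shear_mem`). Whitehead's lemma and an Eilenberg swindle put every `diag (u, 1)` in
`N`. For arbitrary `g`, `exists_splitting_of_automorphism` finds a decomposition whose first factor
contains a split copy of `F` that `g` carries to another split copy inside that factor. Multiplying
`g` by shears then makes it fix the second factor pointwise, so it becomes a shear times some `diag
(u, 1)`. -/

/-- Transport of automorphisms along a linear equivalence, as a group homomorphism. -/
def transportAut {A M : Type*} [AddCommGroup A] [AddCommGroup M] (e : A ≃ₗ[ℤ] M) :
    (M ≃ₗ[ℤ] M) →* (A ≃ₗ[ℤ] A) where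
  toFun k := (e.trans k).trans e.symm
  map_one' := by ext a; simp
  map_mul' k l := by ext a; simp

theorem transportAut_apply {A M : Type*} [AddCommGroup A] [AddCommGroup M] (e : A ≃ₗ[ℤ] M)
    (k : M ≃ₗ[ℤ] M) (a : A) : transportAut e k a = e.symm (k (e a)) := rfl

/-- The automorphism `(x, y) ↦ (x, y + f x)` of `P × Q`. -/
def shear {P Q : Type*} [AddCommGroup P] [AddCommGroup Q] (f : P →ₗ[ℤ] Q) :
    (P × Q) ≃ₗ[ℤ] (P × Q) :=
  (LinearEquiv.refl ℤ P).skewProd (LinearEquiv.refl ℤ Q) f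

theorem shear_apply {P Q : Type*} [AddCommGroup P] [AddCommGroup Q] (f : P →ₗ[ℤ] Q)
    (x : P × Q) : shear f x = (x.1, x.2 + f x.1) := rfl

theorem shear_add {P Q : Type*} [AddCommGroup P] [AddCommGroup Q] (f g : P →ₗ[ℤ] Q) :
    shear (f + g) = shear f * shear g := by
  refine LinearEquiv.ext fun x => ?_
  simp only [LinearEquiv.mul_apply, shear_apply, LinearMap.add_apply]
  rw [add_assoc, add_comm (g x.1)]

theorem Subgroup.Normal.transportAut_mem_of_conj {A M M' : Type*} [AddCommGroup A]
    [AddCommGroup M] [AddCommGroup M'] {N : Subgroup (A ≃ₗ[ℤ] A)} (hN : N.Normal)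
    (e : A ≃ₗ[ℤ] M) (e' : A ≃ₗ[ℤ] M') (γ : M ≃ₗ[ℤ] M') {k : M ≃ₗ[ℤ] M} {k' : M' ≃ₗ[ℤ] M'}
    (h : ∀ x, k' (γ x) = γ (k x)) (hk : transportAut e k ∈ N) : transportAut e' k' ∈ N := by
  have := hN.conj_mem _ hk ((e.trans γ).trans e'.symm)
  convert this using 1
  rw [eq_mul_inv_iff_mul_eq]
  refine LinearEquiv.ext fun a => ?_
  simp [LinearEquiv.mul_apply, transportAut_apply, h]

/-- Every endomorphism of `K × K` is a sum of four automorphisms. -/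
theorem mem_of_linearEquiv_mem {K : Type*} [AddCommGroup K]
    (p : (K × K →ₗ[ℤ] K × K) → Prop) (hadd : ∀ f g, p f → p g → p (f + g))
    (hequiv : ∀ f : (K × K) ≃ₗ[ℤ] (K × K), p f) (f : K × K →ₗ[ℤ] K × K) : p f := by
  let a := LinearMap.fst ℤ K K ∘ₗ f ∘ₗ LinearMap.inl ℤ K K
  let b := LinearMap.fst ℤ K K ∘ₗ f ∘ₗ LinearMap.inr ℤ K K
  let c := LinearMap.snd ℤ K K ∘ₗ f ∘ₗ LinearMap.inl ℤ K K
  let d := LinearMap.snd ℤ K K ∘ₗ f ∘ₗ LinearMap.inr ℤ K K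
  let sw := LinearEquiv.prodComm ℤ K K
  let ng := LinearEquiv.neg ℤ (M := K)
  -- In block form: `[a 1; 1 0] + [0 -1; -1 d]` is the diagonal of `f`, and `[1 b; 0 1] + [-1 0; c
  -- -1]` is the rest.
  have h := hadd _ _ (hadd _ _ (hequiv ((shear a).trans sw)) (hequiv (sw.trans (ng.skewProd ng d))))
    (hadd _ _ (hequiv ((sw.trans (shear b)).trans sw)) (hequiv (ng.skewProd ng c)))
  convert h using 1
  have h0 : f (0, 0) = 0 := map_zero f
  ext x <;> simp [h0, a, b, c, d, sw, ng, shear_apply, LinearEquiv.skewProd_apply]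

/-! ### Shears and block-diagonal automorphisms in a normal subgroup -/

section shears

variable {A : Type*} [AddCommGroup A] {B P Q : Type*} [AddCommGroup B] [AddCommGroup P]
  [AddCommGroup Q] {N : Subgroup (A ≃ₗ[ℤ] A)}

theorem Subgroup.Normal.transportAut_shear_mem (hN : N.Normal) (e₀ : A ≃ₗ[ℤ] B × B)
    (h₀ : transportAut e₀ (shear LinearMap.id) ∈ N) (δ : B ≃ₗ[ℤ] B × B) (α : B ≃ₗ[ℤ] P)
    (β : B ≃ₗ[ℤ] Q) (e : A ≃ₗ[ℤ] P × Q) (f : P →ₗ[ℤ] Q) : transportAut e (shear f) ∈ N := by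
  let α' := δ.symm.trans α
  let β' := δ.symm.trans β
  have key := mem_of_linearEquiv_mem
    (fun f : B × B →ₗ[ℤ] B × B => transportAut (e.trans (α'.symm.prodCongr β'.symm)) (shear f) ∈ N)
    (fun f g hf hg => by
      rw [shear_add, map_mul]
      exact N.mul_mem hf hg)
    -- Conjugating by `diag (1, f)` turns the shear by the identity into the shear by `f`.
    (fun f => hN.transportAut_mem_of_conj e₀ _ (δ.prodCongr (δ.trans f))
      (fun x => by simp [shear_apply]) h₀)
    (β'.symm.toLinearMap ∘ₗ f ∘ₗ α'.toLinearMap)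
  refine hN.transportAut_mem_of_conj _ e (α'.prodCongr β') (fun x => ?_) key
  simp [shear_apply]

/-- Whitehead's lemma: `diag (1, V, V⁻¹)` is a product of shears. -/
theorem Subgroup.Normal.transportAut_diag_inv_mem {C D : Type*} [AddCommGroup C] [AddCommGroup D]
    (hN : N.Normal) (e₀ : A ≃ₗ[ℤ] B × B)
    (h₀ : transportAut e₀ (shear LinearMap.id) ∈ N) (δ : B ≃ₗ[ℤ] B × B)
    (α : B ≃ₗ[ℤ] D) (β : B ≃ₗ[ℤ] C × D) (e : A ≃ₗ[ℤ] C × D × D) (V : D ≃ₗ[ℤ] D) :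
    transportAut e ((LinearEquiv.refl ℤ C).prodCongr (V.prodCongr V.symm)) ∈ N := by
  let γ₁ : (C × D × D) ≃ₗ[ℤ] D × C × D :=
    { toFun := fun x => (x.2.1, x.1, x.2.2)
      invFun := fun x => (x.2.1, x.1, x.2.2)
      map_add' := fun _ _ => rfl
      map_smul' := fun _ _ => rfl
      left_inv := fun _ => rfl
      right_inv := fun _ => rfl }
  let γ₂ : (C × D × D) ≃ₗ[ℤ] D × C × D :=
    { toFun := fun x => (x.2.2, x.1, x.2.1)
      invFun := fun x => (x.2.1, x.2.2, x.1)
      map_add' := fun _ _ => rfl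
      map_smul' := fun _ _ => rfl
      left_inv := fun _ => rfl
      right_inv := fun _ => rfl }
  have h1 (f : D →ₗ[ℤ] D) := hN.transportAut_shear_mem e₀ h₀ δ α β (e.trans γ₁)
    (LinearMap.inr ℤ C D ∘ₗ f)
  have h2 (f : D →ₗ[ℤ] D) := hN.transportAut_shear_mem e₀ h₀ δ α β (e.trans γ₂)
    (LinearMap.inr ℤ C D ∘ₗ f)
  -- The first three shears give `(p, q) ↦ (V q, -V⁻¹ p)`, the last three `(p, q) ↦ (-q, p)`.
  have key := N.mul_mem (N.mul_mem (h2 V) (N.mul_mem (h1 (-V.symm.toLinearMap)) (h2 V)))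
    (N.mul_mem (h2 (-LinearMap.id)) (N.mul_mem (h1 LinearMap.id) (h2 (-LinearMap.id))))
  convert key using 1
  refine LinearEquiv.ext fun a => ?_
  obtain ⟨x, rfl⟩ := e.symm.surjective a
  obtain ⟨c, p, q⟩ := x
  simp [LinearEquiv.mul_apply, transportAut_apply, shear_apply, γ₁, γ₂]

/-- The Eilenberg swindle: `diag (u, 1)` lies in `N`. -/
theorem Subgroup.Normal.transportAut_diag_one_mem {C D : Type*} [AddCommGroup C] [AddCommGroup D]
    (hN : N.Normal) (e₀ : A ≃ₗ[ℤ] B × B)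
    (h₀ : transportAut e₀ (shear LinearMap.id) ∈ N) (δ : B ≃ₗ[ℤ] B × B)
    (α : B ≃ₗ[ℤ] D) (β : B ≃ₗ[ℤ] C × D) (e : A ≃ₗ[ℤ] C × B)
    (u : C ≃ₗ[ℤ] C) (U : D ≃ₗ[ℤ] D) (σ : D ≃ₗ[ℤ] C × D)
    (hσ : ∀ d, σ (U d) = (u (σ d).1, U (σ d).2)) :
    transportAut e (u.prodCongr (LinearEquiv.refl ℤ B)) ∈ N := by
  let e' : A ≃ₗ[ℤ] C × D × D :=
    e.trans ((LinearEquiv.refl ℤ C).prodCongr (δ.trans (α.prodCongr α)))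
  have h2 := hN.transportAut_diag_inv_mem e₀ h₀ δ α β e' U
  -- Absorbing `C` into `D` by `σ`, this is `diag (u, U, U⁻¹)`; dividing by `diag (1, U, U⁻¹)`
  -- leaves `diag (u, 1, 1)`.
  have h1 := hN.transportAut_diag_inv_mem (C := PUnit.{1}) e₀ h₀ δ α
    (α.trans LinearEquiv.uniqueProd.symm)
    ((e'.trans ((LinearEquiv.prodAssoc ℤ C D D).symm.trans
      (σ.symm.prodCongr (LinearEquiv.refl ℤ D)))).trans LinearEquiv.uniqueProd.symm) U
  have key := N.mul_mem h1 (N.inv_mem h2)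
  rw [← map_inv] at key
  convert key using 1
  refine LinearEquiv.ext fun a => ?_
  obtain ⟨x, rfl⟩ := e'.symm.surjective a
  obtain ⟨c, p, q⟩ := x
  have hs (c d) : σ (U (σ.symm (c, d))) = (u c, U d) := by simp [hσ]
  have hinv : ((LinearEquiv.refl ℤ C).prodCongr (U.prodCongr U.symm))⁻¹ =
    (LinearEquiv.refl ℤ C).prodCongr (U.symm.prodCongr U) := rfl
  rw [hinv]
  simp [LinearEquiv.mul_apply, transportAut_apply, e', hs, LinearEquiv.uniqueProd]
  change c = c ∧ p = U (U.symm p) ∧ q = U.symm (U q)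
  simp

end shears

/-! ### Disjoint finite supports -/

-- A maximal disjoint family has at least `#J` members: otherwise its union, a union of finite sets,
-- has fewer than `#J` elements and the family could be enlarged.
open Cardinal in
theorem exists_pairwise_disjoint_finset {J : Type*} [Infinite J] (p : Finset J → Prop)
    (h : ∀ S : Set J, #S < #J → ∃ T : Finset J, p T ∧ T.Nonempty ∧ Disjoint (T : Set J) S) :
    ∃ T : J → Finset J, (∀ j, p (T j) ∧ (T j).Nonempty) ∧
      ∀ i j, i ≠ j → Disjoint (T i) (T j) := by
  obtain ⟨F, hF⟩ := zorn_subset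
    {F : Set (Finset J) | (∀ T ∈ F, p T ∧ T.Nonempty) ∧ F.PairwiseDisjoint id} (by
      intro c hc hchain
      refine ⟨⋃₀ c, ⟨?_, ?_⟩, fun s hs => Set.subset_sUnion_of_mem hs⟩
      · rintro T ⟨s, hs, hT⟩
        exact (hc hs).1 T hT
      · exact (Set.pairwiseDisjoint_sUnion hchain.directedOn).2 fun s hs => (hc hs).2)
  have hcard : #J ≤ #F := by
    by_contra! hlt
    have hS : #(⋃ T : F, (T.1 : Set J)) < #J := by
      rcases finite_or_infinite F with hfin | hinf
      · exact (Cardinal.lt_aleph0_iff_set_finite.2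
          (Set.finite_iUnion fun T => T.1.finite_toSet)).trans_le (Cardinal.aleph0_le_mk J)
      · refine lt_of_le_of_lt (Cardinal.mk_iUnion_le_sum_mk.trans ?_) hlt
        refine (Cardinal.sum_le_sum _ (fun _ => ℵ₀) fun T => ?_).trans ?_
        · exact (Cardinal.lt_aleph0_iff_set_finite.2 T.1.finite_toSet).le
        · rw [Cardinal.sum_const']
          exact (Cardinal.mul_aleph0_eq (Cardinal.aleph0_le_mk F)).le
    obtain ⟨T, hpT, hne, hdisj⟩ := h _ hS
    have hTd : ∀ T' ∈ F, Disjoint T T' := fun T' hT' =>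
      Finset.disjoint_coe.1 (hdisj.mono_right (Set.subset_iUnion_of_subset ⟨T', hT'⟩ subset_rfl))
    have hTF : T ∈ F := hF.2 (y := insert T F) ⟨?_, ?_⟩ (Set.subset_insert _ _)
      (Set.mem_insert _ _)
    · exact hne.ne_empty (disjoint_self.1 (hTd T hTF))
    · rintro T' (rfl | hT')
      exacts [⟨hpT, hne⟩, hF.1.1 T' hT']
    · exact hF.1.2.insert fun T' hT' _ => hTd T' hT'
  obtain ⟨f⟩ := Cardinal.le_def _ _ |>.1 hcard
  exact ⟨fun j => (f j).1, fun j => hF.1.1 _ (f j).2, fun i j hij =>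
    hF.1.2 (f i).2 (f j).2 fun h => hij (f.injective (Subtype.ext h))⟩

/-! ### Primitive vectors and splittings adapted to an automorphism -/

section primitive

variable {J A : Type*} [AddCommGroup A]

/-- The values at `x` of all functionals form an ideal of `ℤ`. Its generator `n` divides every
coordinate of `x`, and a functional with value `n` at `x` is 1 on the quotient vector. -/
theorem Module.Basis.exists_eq_smul_of_ne_zero (b : Module.Basis J ℤ A) {x : A} (hx : x ≠ 0) :
    ∃ (n : ℤ) (y : A) (l : A →ₗ[ℤ] ℤ), n ≠ 0 ∧ x = n • y ∧ l y = 1 := by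
  let W : Submodule ℤ ℤ := LinearMap.range (LinearMap.applyₗ (R := ℤ) (M₂ := ℤ) x)
  obtain ⟨n, hn⟩ := (inferInstance : W.IsPrincipal).principal
  have hdvd (l : A →ₗ[ℤ] ℤ) : n ∣ l x := by
    have : l x ∈ W := ⟨l, rfl⟩
    rw [hn] at this
    exact Ideal.mem_span_singleton.1 this
  obtain ⟨l, hl⟩ : n ∈ W := by
    rw [hn]
    exact Submodule.mem_span_singleton_self n
  replace hl : l x = n := hl
  have hmul : x = n • b.repr.symm ((b.repr x).mapRange (· / n) (by simp)) := by
    apply b.repr.injective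
    ext j
    have : n ∣ b.repr x j := hdvd (b.coord j)
    simp [Int.mul_ediv_cancel' this]
  have hn0 : n ≠ 0 := by
    rintro rfl
    exact hx (by simpa using hmul)
  refine ⟨n, _, l, hn0, hmul, ?_⟩
  have h2 := congrArg l hmul
  rw [map_smul, hl, smul_eq_mul] at h2
  exact mul_left_cancel₀ hn0 (by rw [← h2, mul_one])

open Cardinal in
theorem Module.Basis.exists_finset_disjoint_primitive [Infinite J] (b : Module.Basis J ℤ A)
    (g : A ≃ₗ[ℤ] A) (S : Set J) (hS : #S < #J) :
    ∃ T : Finset J, (∃ x ∈ Submodule.span ℤ (b '' T), g x ∈ Submodule.span ℤ (b '' T) ∧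
      ∃ l : A →ₗ[ℤ] ℤ, l x = 1) ∧ T.Nonempty ∧ Disjoint (T : Set J) S := by
  classical
  let φ : ((Sᶜ : Set J) →₀ ℤ) →ₗ[ℤ] (S →₀ ℤ) :=
    Finsupp.lsubtypeDomain S ∘ₗ b.repr.toLinearMap ∘ₗ g.toLinearMap ∘ₗ
      Finsupp.linearCombination ℤ (fun j : (Sᶜ : Set J) => b j)
  -- The basis vectors outside `S` span rank `#J > #S`, so some nonzero combination has an image
  -- under `g` with no coordinates in `S`.
  have hφ : ¬ Function.Injective φ := fun hinj => by
    have := LinearMap.rank_le_of_injective φ hinj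
    simp only [rank_finsupp_self, Cardinal.mk_compl_of_infinite S hS, Cardinal.lift_le] at this
    exact this.not_gt hS
  rw [← LinearMap.ker_eq_bot, Submodule.eq_bot_iff] at hφ
  push Not at hφ
  obtain ⟨v, hv, hv0⟩ := hφ
  set x₀ := Finsupp.linearCombination ℤ (fun j : (Sᶜ : Set J) => b j) v with hx₀
  have hx0 : x₀ ≠ 0 := fun h => hv0
    ((linearIndependent_iff.1 (b.linearIndependent.comp _ Subtype.val_injective)) v h)
  have hsupp : ∀ j ∈ S, b.repr x₀ j = 0 := by
    have : x₀ ∈ Submodule.span ℤ (b '' (Sᶜ : Set J)) := by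
      rw [hx₀, Finsupp.linearCombination_apply]
      exact Submodule.sum_mem _ fun j _ => Submodule.smul_mem _ _
        (Submodule.subset_span ⟨j, j.2, rfl⟩)
    rw [b.mem_span_image] at this
    intro j hj
    by_contra hne
    exact this (Finsupp.mem_support_iff.2 hne) hj
  have hgsupp : ∀ j ∈ S, b.repr (g x₀) j = 0 := fun j hj => DFunLike.congr_fun hv ⟨j, hj⟩
  obtain ⟨n, x, l, hn, hxn, hl⟩ := b.exists_eq_smul_of_ne_zero hx0
  have hx : ∀ j ∈ S, b.repr x j = 0 := fun j hj => by
    simpa [hxn, hn] using hsupp j hj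
  have hgx : ∀ j ∈ S, b.repr (g x) j = 0 := fun j hj => by
    simpa [hxn, hn] using hgsupp j hj
  refine ⟨(b.repr x).support ∪ (b.repr (g x)).support, ⟨x, ?_, ?_, l, hl⟩, ?_, ?_⟩
  · rw [b.mem_span_image]
    simp
  · rw [b.mem_span_image]
    simp
  · refine Finset.Nonempty.mono Finset.subset_union_left ?_
    rw [Finsupp.support_nonempty_iff]
    rintro h
    simp [b.repr.map_eq_zero_iff.1 h] at hl
  · rw [Set.disjoint_left]
    intro j hj hjS
    simp [hx j hjS, hgx j hjS] at hj

theorem Module.Basis.exists_linearMap_eq_single {I : Type*} (b : Module.Basis J ℤ A)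
    (T : I → Finset J) (hT : ∀ i j, i ≠ j → Disjoint (T i) (T j)) (x : I → A)
    (hx : ∀ i, x i ∈ Submodule.span ℤ (b '' T i)) (l : I → A →ₗ[ℤ] ℤ) (hl : ∀ i, l i (x i) = 1) :
    ∃ r : A →ₗ[ℤ] (I →₀ ℤ), ∀ i, r (x i) = Finsupp.single i 1 := by
  classical
  let r : A →ₗ[ℤ] (I →₀ ℤ) := b.constr ℤ fun j =>
    if h : ∃ i, j ∈ T i then Finsupp.single h.choose (l h.choose (b j)) else 0
  refine ⟨r, fun i => ?_⟩
  have heq : Set.EqOn r (Finsupp.lsingle i ∘ₗ l i) (b '' T i) := by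
    rintro _ ⟨j, hj, rfl⟩
    have h : ∃ i, j ∈ T i := ⟨i, hj⟩
    have hi : h.choose = i := by
      by_contra hne
      exact Finset.disjoint_left.1 (hT _ _ hne) h.choose_spec hj
    simp only [r, Module.Basis.constr_basis, dif_pos h, hi]
    rfl
  rw [LinearMap.eqOn_span heq (hx i)]
  simp [hl]

theorem Module.Basis.exists_splitting_of_automorphism {I : Type*} [Infinite I]
    (b : Module.Basis (I ⊕ I) ℤ A) (g : A ≃ₗ[ℤ] A) :
    ∃ (e : A ≃ₗ[ℤ] (I →₀ ℤ) × (I →₀ ℤ)) (ι ι' r r' : (I →₀ ℤ) →ₗ[ℤ] (I →₀ ℤ)),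
      (∀ v, r (ι v) = v) ∧ (∀ v, r' (ι' v) = v) ∧
      ∀ v, g (e.symm (ι v, 0)) = e.symm (ι' v, 0) := by
  obtain ⟨T, hT, hdisj⟩ := exists_pairwise_disjoint_finset _
    (b.exists_finset_disjoint_primitive g)
  choose hx hne using hT
  choose x hx hgx l hl using hx
  -- Only the `inl` blocks are used; the `inr` blocks keep the complement of `J₁` of cardinality
  -- `#I`.
  let J₁ : Set (I ⊕ I) := {j | ∃ i : I, j ∈ T (Sum.inl i)}
  have hII : Cardinal.mk (I ⊕ I) = Cardinal.mk I := by simp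
  choose t ht using hne
  have htinj : Function.Injective t := fun i j hij => by
    by_contra hne
    exact Finset.disjoint_left.1 (hdisj i j hne) (ht i) (hij ▸ ht j)
  obtain ⟨ε₁⟩ : Nonempty (I ≃ J₁) := by
    rw [← Cardinal.eq]
    refine le_antisymm (Cardinal.mk_le_of_injective
      (f := fun i => (⟨t (Sum.inl i), i, ht _⟩ : J₁)) fun i j h => ?_)
      ((Cardinal.mk_set_le J₁).trans hII.le)
    exact Sum.inl_injective (htinj (congrArg Subtype.val h))
  obtain ⟨ε₂⟩ : Nonempty (I ≃ (J₁ᶜ : Set (I ⊕ I))) := by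
    rw [← Cardinal.eq]
    refine le_antisymm (Cardinal.mk_le_of_injective
      (f := fun i => (⟨t (Sum.inr i), ?_⟩ : (J₁ᶜ : Set (I ⊕ I)))) fun i j h => ?_)
      ((Cardinal.mk_set_le _).trans hII.le)
    · rintro ⟨k, hk⟩
      exact Finset.disjoint_left.1 (hdisj (Sum.inr i) (Sum.inl k) (by simp)) (ht _) hk
    · exact Sum.inr_injective (htinj (congrArg Subtype.val h))
  classical
  let ε : I ⊕ I ≃ I ⊕ I := (Equiv.sumCongr ε₁ ε₂).trans (Equiv.Set.sumCompl J₁)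
  let e : A ≃ₗ[ℤ] (I →₀ ℤ) × (I →₀ ℤ) :=
    (b.reindex ε.symm).repr.trans (Finsupp.sumFinsuppLEquivProdFinsupp ℤ)
  have he (i : I) {y : A} (hy : y ∈ Submodule.span ℤ (b '' T (Sum.inl i))) : (e y).2 = 0 := by
    have heq : Set.EqOn (LinearMap.snd ℤ _ _ ∘ₗ e.toLinearMap) (0 : A →ₗ[ℤ] I →₀ ℤ)
        (b '' T (Sum.inl i)) := by
      rintro _ ⟨j, hj, rfl⟩
      have hj1 : j ∈ J₁ := ⟨i, hj⟩
      obtain ⟨k, hk⟩ := ε₁.surjective ⟨j, hj1⟩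
      have : j = ε (Sum.inl k) := by simp [ε, hk]
      ext m
      simp [e, this]
    exact LinearMap.eqOn_span heq hy
  have hd : ∀ i j : I, i ≠ j → Disjoint (T (Sum.inl i)) (T (Sum.inl j)) := fun i j hij =>
    hdisj _ _ (Sum.inl_injective.ne hij)
  obtain ⟨r, hr⟩ := b.exists_linearMap_eq_single (fun i : I => T (Sum.inl i)) hd
    (fun i => x (Sum.inl i)) (fun i => hx _) (fun i => l (Sum.inl i)) (fun i => hl _)
  obtain ⟨r', hr'⟩ := b.exists_linearMap_eq_single (fun i : I => T (Sum.inl i)) hd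
    (fun i => g (x (Sum.inl i))) (fun i => hgx _) (fun i => l (Sum.inl i) ∘ₗ g.symm.toLinearMap)
    (fun i => by simp [hl])
  let X : (I →₀ ℤ) →ₗ[ℤ] A := Finsupp.linearCombination ℤ fun i => x (Sum.inl i)
  have hX (v) : e.symm ((e (X v)).1, 0) = X v := by
    rw [LinearEquiv.symm_apply_eq]
    refine Prod.ext rfl (Eq.symm ?_)
    have : LinearMap.snd ℤ _ _ ∘ₗ e.toLinearMap ∘ₗ X = 0 := by
      refine Finsupp.lhom_ext' fun i => LinearMap.ext_ring ?_
      simpa [X] using he i (hx _)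
    exact LinearMap.congr_fun this v
  have hgX (v) : e.symm ((e (g (X v))).1, 0) = g (X v) := by
    rw [LinearEquiv.symm_apply_eq]
    refine Prod.ext rfl (Eq.symm ?_)
    have : LinearMap.snd ℤ _ _ ∘ₗ e.toLinearMap ∘ₗ g.toLinearMap ∘ₗ X = 0 := by
      refine Finsupp.lhom_ext' fun i => LinearMap.ext_ring ?_
      simpa [X] using he i (hgx _)
    exact LinearMap.congr_fun this v
  have hrX (v) : r (X v) = v := by
    have : r ∘ₗ X = LinearMap.id := by
      refine Finsupp.lhom_ext' fun i => LinearMap.ext_ring ?_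
      simpa [X] using hr i
    exact LinearMap.congr_fun this v
  have hrgX (v) : r' (g (X v)) = v := by
    have : r' ∘ₗ g.toLinearMap ∘ₗ X = LinearMap.id := by
      refine Finsupp.lhom_ext' fun i => LinearMap.ext_ring ?_
      simpa [X] using hr' i
    exact LinearMap.congr_fun this v
  refine ⟨e, LinearMap.fst ℤ _ _ ∘ₗ e.toLinearMap ∘ₗ X,
    LinearMap.fst ℤ _ _ ∘ₗ e.toLinearMap ∘ₗ g.toLinearMap ∘ₗ X,
    r ∘ₗ e.symm.toLinearMap ∘ₗ LinearMap.inl ℤ _ _,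
    r' ∘ₗ e.symm.toLinearMap ∘ₗ LinearMap.inl ℤ _ _, fun v => ?_, fun v => ?_, fun v => ?_⟩
  · simp [hX, hrX]
  · simp [hgX, hrgX]
  · simp [hX, hgX]

end primitive

/-! ### Reduction of an arbitrary automorphism -/

/-- An automorphism of `P × Q` fixing `Q` pointwise is a product of a shear and `diag (u, 1)`. -/
theorem exists_eq_shear_mul_diag {P Q : Type*} [AddCommGroup P] [AddCommGroup Q]
    (k : (P × Q) ≃ₗ[ℤ] (P × Q)) (hk : ∀ q, k (0, q) = (0, q)) :
    ∃ (u : P ≃ₗ[ℤ] P) (f : P →ₗ[ℤ] Q),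
      k = shear f * u.prodCongr (LinearEquiv.refl ℤ Q) := by
  have hk' : ∀ q, k.symm (0, q) = (0, q) := fun q => by
    rw [LinearEquiv.symm_apply_eq, hk]
  have hadd (k : (P × Q) ≃ₗ[ℤ] (P × Q)) (hk : ∀ q, k (0, q) = (0, q)) (p q) :
      k (p, q) = ((k (p, 0)).1, (k (p, 0)).2 + q) := by
    have : (p, q) = (p, 0) + (0, q) := by simp
    rw [this, map_add, hk]
    ext <;> simp
  let u : P ≃ₗ[ℤ] P := LinearEquiv.ofLinearMap
    (LinearMap.fst ℤ P Q ∘ₗ k.toLinearMap ∘ₗ LinearMap.inl ℤ P Q)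
    (LinearMap.fst ℤ P Q ∘ₗ k.symm.toLinearMap ∘ₗ LinearMap.inl ℤ P Q)
    (LinearMap.ext fun p => by
      have h := congrArg Prod.fst (k.apply_symm_apply (p, 0))
      rw [← Prod.mk.eta (p := k.symm (p, 0)), hadd k hk] at h
      exact h)
    (LinearMap.ext fun p => by
      have h := congrArg Prod.fst (k.symm_apply_apply (p, 0))
      rw [← Prod.mk.eta (p := k (p, 0)), hadd k.symm hk'] at h
      exact h)
  refine ⟨u, LinearMap.snd ℤ P Q ∘ₗ k.toLinearMap ∘ₗ LinearMap.inl ℤ P Q ∘ₗ u.symm.toLinearMap,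
    LinearEquiv.ext fun ⟨p, q⟩ => ?_⟩
  rw [hadd k hk]
  simp only [LinearEquiv.mul_apply, shear_apply, LinearEquiv.prodCongr_apply,
    LinearEquiv.refl_apply, LinearMap.comp_apply, LinearEquiv.coe_coe,
    LinearEquiv.symm_apply_apply]
  rw [add_comm q]
  rfl

theorem Subgroup.Normal.eq_top_of_transportAut_shear_mem {A : Type*} [AddCommGroup A] {I : Type*}
    [Infinite I] (b : Module.Basis (I ⊕ I) ℤ A) {N : Subgroup (A ≃ₗ[ℤ] A)} (hN : N.Normal)
    (e₀ : A ≃ₗ[ℤ] (I →₀ ℤ) × (I →₀ ℤ))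
    (h₀ : transportAut e₀ (shear LinearMap.id) ∈ N) : N = ⊤ := by
  obtain ⟨ε⟩ : Nonempty (I ≃ I ⊕ I) := Cardinal.eq.1 (by simp)
  obtain ⟨η⟩ : Nonempty (I ≃ ℕ × I) := Cardinal.eq.1 (by simp)
  let δ : (I →₀ ℤ) ≃ₗ[ℤ] (I →₀ ℤ) × (I →₀ ℤ) :=
    (Finsupp.domLCongr ε).trans (Finsupp.sumFinsuppLEquivProdFinsupp ℤ)
  let α : (I →₀ ℤ) ≃ₗ[ℤ] (ℕ →₀ I →₀ ℤ) :=
    (Finsupp.domLCongr η).trans (Finsupp.curryLinearEquiv ℤ)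
  -- Splitting off one of the countably many copies commutes with applying `u` to each copy, as the
  -- swindle requires.
  let σ : (ℕ →₀ I →₀ ℤ) ≃ₗ[ℤ] (I →₀ ℤ) × (ℕ →₀ I →₀ ℤ) :=
    ((Finsupp.domLCongr (Equiv.natSumPUnitEquivNat.symm.trans (Equiv.sumComm ℕ PUnit.{1}))).trans
      (Finsupp.sumFinsuppLEquivProdFinsupp ℤ)).trans
      ((Finsupp.uniqueLinearEquiv ℤ (I →₀ ℤ) PUnit.unit).prodCongr (LinearEquiv.refl ℤ _))
  have hdiag (e : A ≃ₗ[ℤ] (I →₀ ℤ) × (I →₀ ℤ)) (u : (I →₀ ℤ) ≃ₗ[ℤ] (I →₀ ℤ)) :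
      transportAut e (u.prodCongr (LinearEquiv.refl ℤ (I →₀ ℤ))) ∈ N := by
    refine hN.transportAut_diag_one_mem e₀ h₀ δ α
      (δ.trans ((LinearEquiv.refl ℤ _).prodCongr α)) e u (Finsupp.mapRange.linearEquiv u) σ
      fun d => ?_
    refine Prod.ext ?_ ?_
    · simp [σ]
    · ext n : 1
      simp [σ]
  have hlow (e : A ≃ₗ[ℤ] (I →₀ ℤ) × (I →₀ ℤ)) (f : (I →₀ ℤ) →ₗ[ℤ] (I →₀ ℤ)) :
      transportAut e (shear f) ∈ N :=
    hN.transportAut_shear_mem e₀ h₀ δ (LinearEquiv.refl ℤ _) (LinearEquiv.refl ℤ _) e f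
  rw [eq_top_iff]
  rintro g -
  obtain ⟨e, ι, ι', r, r', hr, hr', hg⟩ := b.exists_splitting_of_automorphism g
  let sw := LinearEquiv.prodComm ℤ (I →₀ ℤ) (I →₀ ℤ)
  let L (f) := transportAut e (shear f)
  let U (f) := transportAut (e.trans sw) (shear f)
  have hL (f) : L f ∈ N := hlow _ f
  have hU (f) : U f ∈ N := hlow _ f
  -- On the second factor: `(0, q) ↦ (ι q, q) ↦ (ι q, 0) ↦ (ι' q, 0) ↦ (ι' q, q) ↦ (0, q)`.
  let h := U (-ι') * L r' * g * (L (-r) * U ι)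
  have hfix : ∀ q, h (e.symm (0, q)) = e.symm (0, q) := fun q => by
    have h1 : (L (-r) * U ι) (e.symm (0, q)) = e.symm (ι q, 0) := by
      simp [L, U, sw, transportAut_apply, shear_apply, hr]
    simp only [h, LinearEquiv.mul_apply] at h1 ⊢
    rw [h1, hg]
    simp [L, U, sw, transportAut_apply, shear_apply, hr']
  obtain ⟨u, f, huf⟩ := exists_eq_shear_mul_diag ((e.symm.trans h).trans e)
    (fun q => by simp [hfix])
  have hh : h = transportAut e ((e.symm.trans h).trans e) := by
    ext a
    simp [transportAut_apply]
  have hmem : h ∈ N := by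
    rw [hh, huf, map_mul]
    exact N.mul_mem (hlow e f) (hdiag e u)
  have h2 := (N.mul_mem_cancel_right (N.mul_mem (hL (-r)) (hU ι))).1 hmem
  exact (N.mul_mem_cancel_left (N.mul_mem (hU (-ι')) (hL r'))).1 h2

theorem mainTheorem9 {A : Type*} [AddCommGroup A] (hA : ¬ AddGroup.FG A)
    {I : Type*} (b : Module.Basis (I ⊕ I) ℤ A) :
    (∃! τ : A ≃ₗ[ℤ] A, ∀ i : I,
      τ (b (Sum.inl i)) = b (Sum.inl i) + b (Sum.inr i) ∧ τ (b (Sum.inr i)) = b (Sum.inr i)) ∧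
    ∀ τ : A ≃ₗ[ℤ] A,
      (∀ i : I, τ (b (Sum.inl i)) = b (Sum.inl i) + b (Sum.inr i) ∧
        τ (b (Sum.inr i)) = b (Sum.inr i)) →
      Subgroup.normalClosure ({τ} : Set (A ≃ₗ[ℤ] A)) = ⊤ := by
  have : Infinite I := by
    by_contra hI
    rw [not_infinite_iff_finite] at hI
    have := Module.Finite.of_basis b
    exact hA (Module.Finite.iff_addGroup_fg.1 this)
  let e₀ : A ≃ₗ[ℤ] (I →₀ ℤ) × (I →₀ ℤ) :=
    b.repr.trans (Finsupp.sumFinsuppLEquivProdFinsupp ℤ)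
  have hl (i : I) : e₀ (b (Sum.inl i)) = (Finsupp.single i 1, 0) := by
    refine Prod.ext ?_ ?_ <;> ext j <;> simp [e₀]
  have hr (i : I) : e₀ (b (Sum.inr i)) = (0, Finsupp.single i 1) := by
    refine Prod.ext ?_ ?_ <;> ext j <;> simp [e₀]
  have hex : ∀ i : I, transportAut e₀ (shear LinearMap.id) (b (Sum.inl i)) =
      b (Sum.inl i) + b (Sum.inr i) ∧
      transportAut e₀ (shear LinearMap.id) (b (Sum.inr i)) = b (Sum.inr i) := fun i => by
    simp only [transportAut_apply, LinearEquiv.symm_apply_eq, map_add, hl, hr, shear_apply]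
    simp
  have huniq (τ : A ≃ₗ[ℤ] A) (hτ : ∀ i : I, τ (b (Sum.inl i)) = b (Sum.inl i) + b (Sum.inr i) ∧
      τ (b (Sum.inr i)) = b (Sum.inr i)) : τ = transportAut e₀ (shear LinearMap.id) := by
    refine b.ext' ?_
    rintro (i | i)
    · rw [(hτ i).1, (hex i).1]
    · rw [(hτ i).2, (hex i).2]
  refine ⟨⟨_, hex, huniq⟩, fun τ hτ => ?_⟩
  refine Subgroup.normalClosure_normal.eq_top_of_transportAut_shear_mem b e₀ ?_
  rw [← huniq τ hτ]
  exact Subgroup.subset_normalClosure rfl
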